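/- Let $\mathbb D=\{z\in\mathbb C:|z|<1\}$ and $\phi(z)=1+\frac{4z}{3}+\frac{2z^2}{3}$. Let $\mathcal S^*_C=\mathcal S^*(\phi)$ be the class of functions $f$ that are analytic and univalent in $\mathbb D$, normalized by $f(0)=0$ and $f'(0)=1$, and such that $zf'(z)/f(z)\prec\phi(z)$; that is, there is an analytic function $\omega:\mathbb D\to\mathbb D$ with $\omega(0)=0$ and $zf'(z)/f(z)=\phi(\omega(z))$ for $z\in\mathbb D$ (where the quotient is given its limit value $1$ at $z=0$). The equation $r\exp\left(\frac{4r}{3}+\frac{r^2}{3}\right)=e^{-1}$ has a smallest root $r_f$ in $(0,1)$, and $0<r_f<\frac13$. For every $f(z)=z+\sum_{n=2}^\infty a_nz^n$ in $\mathcal S^*_C$ the Bohr inequality $$|z|+\sum_{n=2}^{\infty}|a_n||z|^n\le d\bigl(f(0),\partial f(\mathbb D)\bigr)$$ holds for all $z$ with $|z|\le r_f$, where $d$ is the Euclidean distance. The radius $r_f$ is best possible: for every $\rho\in(r_f,1)$ there are $f\in\mathcal S^*_C$ and $z$ with $|z|=\rho$ for which this inequality fails. -/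

import Mathlib

/-- `p ≺ q` in the open unit disk: `p(z) = q(ω(z))` for `|z| < 1`, with `ω` an analytic self-map of
the open unit disk such that `ω(0) = 0`. -/
def Subordinate (p q : ℂ → ℂ) : Prop :=
  ∃ ω : ℂ → ℂ, DifferentiableOn ℂ ω (Metric.ball 0 1) ∧
    Set.MapsTo ω (Metric.ball 0 1) (Metric.ball 0 1) ∧ ω 0 = 0 ∧
    ∀ z ∈ Metric.ball (0 : ℂ) 1, p z = q (ω z)

/-- The class `𝓢` of normalized univalent functions in the open unit disk. Functions are total on
`ℂ`, and only their restriction to the open unit disk matters. -/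
def classS : Set (ℂ → ℂ) :=
  {f | DifferentiableOn ℂ f (Metric.ball 0 1) ∧ f 0 = 0 ∧ deriv f 0 = 1 ∧
    Set.InjOn f (Metric.ball 0 1)}

/-- The function `z f'(z) / f(z)`, with its removable singularity at `0` filled in by the limit `1`
(for `f` with `f(0) = 0` and `f'(0) = 1`). -/
noncomputable def starlikeQuotient (f : ℂ → ℂ) (z : ℂ) : ℂ :=
  if z = 0 then 1 else z * deriv f z / f z

/-- The Ma-Minda class `𝓢*(φ)`: functions `f ∈ 𝓢` such that `z f'(z) / f(z) ≺ φ(z)`. -/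
def starlikeClass (φ : ℂ → ℂ) : Set (ℂ → ℂ) :=
  {f | f ∈ classS ∧ Subordinate (starlikeQuotient f) φ}

/-- The cardioid class `𝓢*_C = 𝓢*(1 + 4z/3 + 2z²/3)`. -/
def cardioidClass : Set (ℂ → ℂ) :=
  starlikeClass (fun z => 1 + 4 * z / 3 + 2 * z ^ 2 / 3)

/-- The `n`-th Taylor coefficient of `f` at `0`. -/
noncomputable def taylorCoeff (f : ℂ → ℂ) (n : ℕ) : ℂ :=
  iteratedDeriv n f 0 / (n.factorial : ℂ)

/-- The Bohr inequality at `z` for a normalized `f(z) = z + ∑_{n ≥ 2} aₙ zⁿ`: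
`|z| + ∑_{n ≥ 2} |aₙ| |z|ⁿ ≤ d(f(0), ∂f(𝔻))`. Both sides are taken in `[0, ∞]`, so that neither the
series nor the distance has a junk value. -/
def BohrInequality (f : ℂ → ℂ) (z : ℂ) : Prop :=
  ‖z‖ₑ + ∑' n : ℕ, ‖taylorCoeff f (n + 2)‖ₑ * ‖z‖ₑ ^ (n + 2) ≤
    Metric.infEDist (f 0) (frontier (f '' Metric.ball 0 1))

/-!
Write `f(z) = z exp(g(z))` with `z g'(z) = φ(ω(z)) - 1`, and let `K(w) = 4w/3 + w²/3`, so that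
`z g'(z) = h(ω(z))` with `h(w) = w K'(w)`. Since `K` is convex univalent, Suffridge's theorem, which
is Jack's lemma applied to `K⁻¹ ∘ g`, gives `g ≺ K`. As `re K ≥ -1` on the disk, `|f(z)| ≥ |z| / e`,
and the boundary of `f(𝔻)` stays at distance at least `1 / e` from `0`.

On the other side `g' = 4ψ/3 + 2ψω/3` with `ψ = ω(z)/z` bounded by `1`. By Bohr's theorem the
majorant series of `ψ` is at most `1` for `t ≤ 1/3`, hence that of `g'` is at most
`4/3 + 2t/3 = K'(t)`. A Grönwall argument turns this into the bound `exp(K(t))` for the majorant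
series of `exp ∘ g`, so the majorant of `f` is at most `t exp(K(t))`, which reaches `1 / e` at
`r_f < 1/3`. For the extremal function `z exp(K(z))` the majorant is at least its value at `t`, and
`-1 / e`, its value at `-1`, lies on the boundary of its image.
-/

open Metric Set Filter Topology

section TaylorCoefficients

variable {f g : ℂ → ℂ}

theorem taylorCoeff_zero (f : ℂ → ℂ) : taylorCoeff f 0 = f 0 := by
  simp [taylorCoeff]

theorem taylorCoeff_one (f : ℂ → ℂ) : taylorCoeff f 1 = deriv f 0 := by
  simp [taylorCoeff]

theorem taylorCoeff_congr (h : f =ᶠ[𝓝 0] g) (n : ℕ) : taylorCoeff f n = taylorCoeff g n := by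
  rw [taylorCoeff, taylorCoeff, h.iteratedDeriv_eq]

theorem taylorCoeff_add (hf : AnalyticAt ℂ f 0) (hg : AnalyticAt ℂ g 0) (n : ℕ) :
    taylorCoeff (fun z => f z + g z) n = taylorCoeff f n + taylorCoeff g n := by
  rw [taylorCoeff, iteratedDeriv_fun_add hf.contDiffAt hg.contDiffAt, add_div, taylorCoeff,
    taylorCoeff]

theorem taylorCoeff_const_mul (c : ℂ) (f : ℂ → ℂ) (n : ℕ) :
    taylorCoeff (fun z => c * f z) n = c * taylorCoeff f n := by
  rw [taylorCoeff, iteratedDeriv_const_mul_field, mul_div_assoc, taylorCoeff]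

theorem taylorCoeff_const_sub {n : ℕ} (hn : n ≠ 0) (c : ℂ) (f : ℂ → ℂ) :
    taylorCoeff (fun z => c - f z) n = -taylorCoeff f n := by
  rw [taylorCoeff, iteratedDeriv_const_sub hn.bot_lt, iteratedDeriv_neg, neg_div, taylorCoeff]

theorem taylorCoeff_mul (hf : AnalyticAt ℂ f 0) (hg : AnalyticAt ℂ g 0) (n : ℕ) :
    taylorCoeff (fun z => f z * g z) n =
      ∑ i ∈ Finset.range (n + 1), taylorCoeff f i * taylorCoeff g (n - i) := by
  rw [taylorCoeff, iteratedDeriv_fun_mul hf.contDiffAt hg.contDiffAt, Finset.sum_div]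
  refine Finset.sum_congr rfl fun i hi => ?_
  have hin : i ≤ n := Finset.mem_range_succ_iff.mp hi
  have hn : (n.factorial : ℂ) ≠ 0 := Nat.cast_ne_zero.mpr n.factorial_ne_zero
  rw [Nat.cast_choose ℂ hin, taylorCoeff, taylorCoeff]
  field_simp

theorem taylorCoeff_id (n : ℕ) : taylorCoeff (fun z => z) n = if n = 1 then 1 else 0 := by
  rcases n with _ | _ | n
  · simp [taylorCoeff]
  · simp [taylorCoeff]
  · have hderiv : deriv (fun z : ℂ => z) = fun _ => 1 := deriv_id'
    simp [taylorCoeff, iteratedDeriv_succ', hderiv]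

theorem taylorCoeff_id_mul_succ (hf : AnalyticAt ℂ f 0) (n : ℕ) :
    taylorCoeff (fun z => z * f z) (n + 1) = taylorCoeff f n := by
  rw [taylorCoeff_mul (f := fun z => z) analyticAt_id hf, Finset.sum_eq_single 1]
  · simp [taylorCoeff_id]
  · intro i _ hi
    simp [taylorCoeff_id, hi]
  · simp

theorem taylorCoeff_deriv (f : ℂ → ℂ) (n : ℕ) :
    taylorCoeff (deriv f) n = (n + 1) * taylorCoeff f (n + 1) := by
  have hn : (n.factorial : ℂ) ≠ 0 := Nat.cast_ne_zero.mpr n.factorial_ne_zero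
  have hn' : (n : ℂ) + 1 ≠ 0 := Nat.cast_add_one_ne_zero n
  rw [taylorCoeff, taylorCoeff, iteratedDeriv_succ', Nat.factorial_succ]
  push_cast
  field_simp

theorem norm_taylorCoeff_mul_le (hf : AnalyticAt ℂ f 0) (hg : AnalyticAt ℂ g 0) (n : ℕ) :
    ‖taylorCoeff (fun z => f z * g z) n‖ ≤
      ∑ i ∈ Finset.range (n + 1), ‖taylorCoeff f i‖ * ‖taylorCoeff g (n - i)‖ := by
  rw [taylorCoeff_mul hf hg]
  exact (norm_sum_le _ _).trans_eq (Finset.sum_congr rfl fun i _ => norm_mul _ _)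

end TaylorCoefficients

section MajorantSum

variable {f g : ℂ → ℂ} {t : ℝ}

/-- The `N`-th partial sum of the Bohr majorant series `∑ |aₙ| tⁿ` of `f(z) = ∑ aₙ zⁿ`. Every
estimate of the majorant is an estimate uniform in `N`, so that no convergence is ever needed. -/
noncomputable def majorantSum (f : ℂ → ℂ) (N : ℕ) (t : ℝ) : ℝ :=
  ∑ n ∈ Finset.range N, ‖taylorCoeff f n‖ * t ^ n

theorem majorantSum_nonneg (f : ℂ → ℂ) (N : ℕ) (ht : 0 ≤ t) : 0 ≤ majorantSum f N t :=
  Finset.sum_nonneg fun _ _ => by positivity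

theorem majorantSum_le_succ (f : ℂ → ℂ) (N : ℕ) (ht : 0 ≤ t) :
    majorantSum f N t ≤ majorantSum f (N + 1) t := by
  rw [majorantSum, majorantSum, Finset.sum_range_succ]
  exact le_add_of_nonneg_right (by positivity)

theorem majorantSum_congr (h : f =ᶠ[𝓝 0] g) (N : ℕ) (t : ℝ) :
    majorantSum f N t = majorantSum g N t := by
  simp only [majorantSum, taylorCoeff_congr h]

theorem majorantSum_const_mul (c : ℂ) (f : ℂ → ℂ) (N : ℕ) (t : ℝ) :
    majorantSum (fun z => c * f z) N t = ‖c‖ * majorantSum f N t := by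
  simp only [majorantSum, taylorCoeff_const_mul, norm_mul, mul_assoc, Finset.mul_sum]

theorem majorantSum_add_le (hf : AnalyticAt ℂ f 0) (hg : AnalyticAt ℂ g 0) (N : ℕ) (ht : 0 ≤ t) :
    majorantSum (fun z => f z + g z) N t ≤ majorantSum f N t + majorantSum g N t := by
  simp only [majorantSum, ← Finset.sum_add_distrib, ← add_mul]
  gcongr with n
  rw [taylorCoeff_add hf hg]
  exact norm_add_le _ _

theorem majorantSum_mul_le (hf : AnalyticAt ℂ f 0) (hg : AnalyticAt ℂ g 0) (N : ℕ) (ht : 0 ≤ t) :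
    majorantSum (fun z => f z * g z) N t ≤ majorantSum f N t * majorantSum g N t := by
  calc majorantSum (fun z => f z * g z) N t
      ≤ ∑ n ∈ Finset.range N, ∑ i ∈ Finset.range (n + 1),
          (‖taylorCoeff f i‖ * t ^ i) * (‖taylorCoeff g (n - i)‖ * t ^ (n - i)) := by
        refine Finset.sum_le_sum fun n _ => ?_
        refine (mul_le_mul_of_nonneg_right (norm_taylorCoeff_mul_le hf hg n)
          (pow_nonneg ht n)).trans_eq ?_
        rw [Finset.sum_mul]
        refine Finset.sum_congr rfl fun i hi => ?_
        rw [← pow_mul_pow_sub t (Finset.mem_range_succ_iff.mp hi)]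
        ring
    _ = ∑ i ∈ Finset.range N, ∑ k ∈ Finset.range (N - i),
          (‖taylorCoeff f i‖ * t ^ i) * (‖taylorCoeff g k‖ * t ^ k) :=
        Finset.sum_range_diag_flip N fun i k =>
          (‖taylorCoeff f i‖ * t ^ i) * (‖taylorCoeff g k‖ * t ^ k)
    _ ≤ ∑ i ∈ Finset.range N, ∑ k ∈ Finset.range N,
          (‖taylorCoeff f i‖ * t ^ i) * (‖taylorCoeff g k‖ * t ^ k) := by
        refine Finset.sum_le_sum fun i _ => ?_
        refine Finset.sum_le_sum_of_subset_of_nonneg (Finset.range_mono (Nat.sub_le N i)) ?_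
        intros
        positivity
    _ = majorantSum f N t * majorantSum g N t := (Finset.sum_mul_sum _ _ _ _).symm

theorem majorantSum_id_le (N : ℕ) (ht : 0 ≤ t) : majorantSum (fun z => z) N t ≤ t := by
  simp only [majorantSum, taylorCoeff_id]
  calc ∑ n ∈ Finset.range N, ‖(if n = 1 then 1 else 0 : ℂ)‖ * t ^ n
      = ∑ n ∈ Finset.range N, if n = 1 then t else 0 :=
        Finset.sum_congr rfl fun n _ => by split_ifs with hn <;> simp [hn]
    _ ≤ t := by rw [Finset.sum_ite_eq' (Finset.range N) 1]; split_ifs <;> simp [ht]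

end MajorantSum

section BohrTheorem

open Real

theorem norm_circleAverage_le {E : Type*} [NormedAddCommGroup E] [NormedSpace ℝ E] (f : ℂ → E)
    (c : ℂ) (R : ℝ) : ‖circleAverage f c R‖ ≤ circleAverage (fun z => ‖f z‖) c R := by
  rw [circleAverage_def, circleAverage_def, norm_smul, Real.norm_of_nonneg (by positivity),
    smul_eq_mul]
  gcongr
  exact intervalIntegral.norm_integral_le_integral_norm two_pi_pos.le

theorem circleAverage_inv_pow_mul {f : ℂ → ℂ} {r : ℝ} (hr : 0 < r)
    (hf : DifferentiableOn ℂ f (closedBall 0 r)) (n : ℕ) :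
    circleAverage (fun z => (z ^ n)⁻¹ * f z) 0 r = taylorCoeff f n := by
  have hintegrand : (fun z : ℂ => (z - 0)⁻¹ • ((z ^ n)⁻¹ * f z)) =
      fun z => (1 / (z - 0) ^ (n + 1)) • f z := by
    ext z
    rw [sub_zero, smul_eq_mul, smul_eq_mul, one_div, pow_succ', mul_inv, mul_assoc]
  rw [circleAverage_eq_circleIntegral hr.ne', hintegrand,
    hf.circleIntegral_one_div_sub_center_pow_smul hr n, taylorCoeff, smul_smul,
    mul_div_assoc', inv_mul_cancel₀ Complex.two_pi_I_ne_zero, smul_eq_mul, one_div_mul_eq_div]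

theorem circleAverage_pow_mul {h : ℂ → ℂ} {r : ℝ} (hr : 0 < r)
    (hh : DifferentiableOn ℂ h (closedBall 0 r)) {n : ℕ} (hn : n ≠ 0) :
    circleAverage (fun z => z ^ n * h z) 0 r = 0 := by
  have hdiff : DiffContOnCl ℂ (fun z => z ^ n * h z) (ball 0 |r|) := by
    refine DifferentiableOn.diffContOnCl ?_
    rw [abs_of_pos hr, closure_ball _ hr.ne']
    exact (differentiableOn_id.pow n).mul hh
  rw [hdiff.circleAverage, zero_pow hn, zero_mul]

theorem circleAverage_re {h : ℂ → ℂ} {r : ℝ} (hr : 0 < r)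
    (hh : DifferentiableOn ℂ h (closedBall 0 r)) :
    circleAverage (fun z => (h z).re) 0 r = (h 0).re := by
  have hmean : circleAverage h 0 r = h 0 := by
    simpa [taylorCoeff_zero] using circleAverage_inv_pow_mul hr hh 0
  have hcomm := Complex.reCLM.circleAverage_comp_comm
    ((hh.continuousOn.mono sphere_subset_closedBall).circleIntegrable hr.le)
  rwa [hmean] at hcomm

theorem circleAverage_inv_pow_mul_two_re {h : ℂ → ℂ} {r : ℝ} (hr : 0 < r)
    (hh : DifferentiableOn ℂ h (closedBall 0 r)) {n : ℕ} (hn : n ≠ 0) :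
    circleAverage (fun z => (z ^ n)⁻¹ * (2 * (h z).re : ℝ)) 0 r = taylorCoeff h n := by
  have hcont : ContinuousOn h (sphere 0 r) := hh.continuousOn.mono sphere_subset_closedBall
  have hz0 : ∀ z ∈ sphere (0 : ℂ) r, z ^ n ≠ 0 := fun z hz =>
    pow_ne_zero n (ne_zero_of_mem_sphere hr.ne' ⟨z, hz⟩)
  have hpow : ContinuousOn (fun z => z ^ n * h z) (sphere 0 r) := (continuousOn_pow n).mul hcont
  have hinv : ContinuousOn (fun z => (z ^ n)⁻¹ * h z) (sphere 0 r) :=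
    ((continuousOn_pow n).inv₀ hz0).mul hcont
  have hconj : circleAverage (fun z => (starRingEnd ℂ) (z ^ n * h z)) 0 r = 0 := by
    have hcomm := (Complex.conjCLE : ℂ →L[ℝ] ℂ).circleAverage_comp_comm
      (hpow.circleIntegrable hr.le)
    rwa [circleAverage_pow_mul hr hh hn, map_zero] at hcomm
  have hsplit : EqOn (fun z => (z ^ n)⁻¹ * (2 * (h z).re : ℝ))
      (fun z => (z ^ n)⁻¹ * h z + ((r : ℂ) ^ (2 * n))⁻¹ • (starRingEnd ℂ) (z ^ n * h z))
      (sphere 0 |r|) := by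
    intro z hz
    rw [abs_of_pos hr] at hz
    have hinv : (z ^ n)⁻¹ = ((r : ℂ) ^ (2 * n))⁻¹ * (starRingEnd ℂ) (z ^ n) := by
      rw [Complex.inv_def, Complex.normSq_eq_norm_sq, norm_pow, mem_sphere_zero_iff_norm.mp hz,
        ← pow_mul, mul_comm n 2, mul_comm]
      push_cast
      rfl
    dsimp only
    rw [map_mul, smul_eq_mul, ← mul_assoc, ← hinv, ← mul_add, Complex.add_conj]
  rw [circleAverage_congr_sphere hsplit, circleAverage_fun_add (hinv.circleIntegrable hr.le),
    circleAverage_fun_smul, hconj, smul_zero, add_zero, circleAverage_inv_pow_mul hr hh]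
  exact ContinuousOn.circleIntegrable hr.le
    ((Complex.continuous_conj.comp_continuousOn hpow).const_smul ((r : ℂ) ^ (2 * n))⁻¹)

theorem norm_taylorCoeff_mul_pow_le {h : ℂ → ℂ} {r : ℝ} (hr : 0 < r)
    (hh : DifferentiableOn ℂ h (closedBall 0 r)) (hre : ∀ z ∈ sphere 0 r, 0 ≤ (h z).re)
    {n : ℕ} (hn : n ≠ 0) : ‖taylorCoeff h n‖ * r ^ n ≤ 2 * (h 0).re := by
  have hnorm : EqOn (fun z => ‖(z ^ n)⁻¹ * ((2 * (h z).re : ℝ) : ℂ)‖)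
      (fun z => (2 * (r ^ n)⁻¹) • (h z).re) (sphere 0 |r|) := by
    intro z hz
    rw [abs_of_pos hr] at hz
    dsimp only
    rw [norm_mul, norm_inv, norm_pow, mem_sphere_zero_iff_norm.mp hz,
      Complex.norm_of_nonneg (mul_nonneg zero_le_two (hre z hz)), smul_eq_mul]
    ring
  rw [← circleAverage_inv_pow_mul_two_re hr hh hn, ← le_div_iff₀ (pow_pos hr n)]
  refine (norm_circleAverage_le _ 0 r).trans_eq ?_
  rw [circleAverage_congr_sphere hnorm, circleAverage_fun_smul, circleAverage_re hr hh, smul_eq_mul,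
    mul_right_comm, div_eq_mul_inv]

theorem norm_taylorCoeff_le_of_norm_le_one {f : ℂ → ℂ} (hf : DifferentiableOn ℂ f (ball 0 1))
    (hbound : ∀ z ∈ ball 0 1, ‖f z‖ ≤ 1) {n : ℕ} (hn : n ≠ 0) :
    ‖taylorCoeff f n‖ ≤ 2 * (1 - ‖f 0‖) := by
  obtain ⟨c, hc, hc0⟩ := Complex.exists_norm_eq_mul_self (f 0)
  have hle : ∀ᶠ r : ℝ in 𝓝[<] 1, ‖taylorCoeff f n‖ * r ^ n ≤ 2 * (1 - ‖f 0‖) := by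
    filter_upwards [Ioo_mem_nhdsLT (zero_lt_one' ℝ)] with r hr
    have hsub : closedBall (0 : ℂ) r ⊆ ball 0 1 := closedBall_subset_ball hr.2
    have hre : ∀ z ∈ sphere (0 : ℂ) r, 0 ≤ (1 - c * f z).re := by
      intro z hz
      have hcf : ‖c * f z‖ ≤ 1 := by
        simpa [hc] using hbound z (hsub (sphere_subset_closedBall hz))
      simpa using (Complex.re_le_norm _).trans hcf
    simpa [taylorCoeff_const_sub hn, taylorCoeff_const_mul, hc, ← hc0] using
      norm_taylorCoeff_mul_pow_le hr.1 (((hf.mono hsub).const_mul c).const_sub 1) hre hn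
  have hlim : Tendsto (fun r : ℝ => ‖taylorCoeff f n‖ * r ^ n) (𝓝[<] 1) (𝓝 ‖taylorCoeff f n‖) :=
    tendsto_nhdsWithin_of_tendsto_nhds <| by
      simpa using (by fun_prop : Continuous fun r : ℝ => ‖taylorCoeff f n‖ * r ^ n).tendsto 1
  exact le_of_tendsto hlim hle

theorem majorantSum_le_one {f : ℂ → ℂ} (hf : DifferentiableOn ℂ f (ball 0 1))
    (hbound : ∀ z ∈ ball 0 1, ‖f z‖ ≤ 1) {t : ℝ} (ht0 : 0 ≤ t) (ht : t ≤ 1 / 3) (N : ℕ) :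
    majorantSum f N t ≤ 1 := by
  have hf0 : 0 ≤ 2 * (1 - ‖f 0‖) := by linarith [hbound 0 (mem_ball_self one_pos)]
  have hgeom : ∑ n ∈ Finset.range N, t ^ (n + 1) ≤ 1 / 2 := by
    calc ∑ n ∈ Finset.range N, t ^ (n + 1) = ∑ n ∈ Finset.Ico 1 (N + 1), t ^ n := by
          rw [Finset.sum_Ico_eq_sum_range, Nat.add_sub_cancel]
          simp only [add_comm]
      _ ≤ t ^ 1 / (1 - t) := geom_sum_Ico_le_of_lt_one ht0 (by linarith)
      _ ≤ 1 / 2 := by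
          rw [pow_one, div_le_iff₀ (by linarith)]
          linarith
  calc majorantSum f N t ≤ majorantSum f (N + 1) t := majorantSum_le_succ f N ht0
    _ = ∑ n ∈ Finset.range N, ‖taylorCoeff f (n + 1)‖ * t ^ (n + 1) + ‖f 0‖ := by
        rw [majorantSum, Finset.sum_range_succ', pow_zero, mul_one, taylorCoeff_zero]
    _ ≤ ∑ n ∈ Finset.range N, 2 * (1 - ‖f 0‖) * t ^ (n + 1) + ‖f 0‖ := by
        gcongr with n
        exact norm_taylorCoeff_le_of_norm_le_one hf hbound n.succ_ne_zero
    _ ≤ 2 * (1 - ‖f 0‖) * (1 / 2) + ‖f 0‖ := by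
        rw [← Finset.mul_sum]
        gcongr
    _ = 1 := by ring

end BohrTheorem

section MajorantOfExp

theorem le_mul_exp_of_hasDerivAt_le_mul {u u' b B : ℝ → ℝ} {x y : ℝ} (hxy : x ≤ y)
    (hu : ∀ s ∈ Icc x y, HasDerivAt u (u' s) s) (hB : ∀ s ∈ Icc x y, HasDerivAt B (b s) s)
    (hle : ∀ s ∈ Ioo x y, u' s ≤ b s * u s) : u y ≤ u x * Real.exp (B y - B x) := by
  have hderiv : ∀ s ∈ Icc x y, HasDerivAt (fun s => u s * Real.exp (-B s))
      ((u' s - b s * u s) * Real.exp (-B s)) s := fun s hs =>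
    ((hu s hs).mul (hB s hs).fun_neg.exp).congr_deriv (by ring)
  have hanti : AntitoneOn (fun s => u s * Real.exp (-B s)) (Icc x y) := by
    refine antitoneOn_of_hasDerivWithinAt_nonpos (convex_Icc x y)
      (fun s hs => (hderiv s hs).continuousAt.continuousWithinAt)
      (fun s hs => (hderiv s (interior_subset hs)).hasDerivWithinAt) fun s hs => ?_
    rw [interior_Icc] at hs
    exact mul_nonpos_of_nonpos_of_nonneg (sub_nonpos.mpr (hle s hs)) (Real.exp_pos _).le
  have hxy' := hanti (left_mem_Icc.mpr hxy) (right_mem_Icc.mpr hxy) hxy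
  calc u y = u y * Real.exp (-B y) * Real.exp (B y) := by
        rw [mul_assoc, ← Real.exp_add, neg_add_cancel, Real.exp_zero, mul_one]
    _ ≤ u x * Real.exp (-B x) * Real.exp (B y) :=
        mul_le_mul_of_nonneg_right hxy' (Real.exp_pos _).le
    _ = u x * Real.exp (B y - B x) := by
        rw [mul_assoc, ← Real.exp_add, neg_add_eq_sub]

theorem hasDerivAt_majorantSum_succ (f : ℂ → ℂ) (N : ℕ) (t : ℝ) :
    HasDerivAt (majorantSum f (N + 1)) (majorantSum (deriv f) N t) t := by
  have hsum : HasDerivAt (majorantSum f (N + 1))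
      (∑ n ∈ Finset.range (N + 1), ‖taylorCoeff f n‖ * (n * t ^ (n - 1))) t :=
    HasDerivAt.fun_sum fun n _ => (hasDerivAt_pow n t).const_mul _
  refine hsum.congr_deriv ?_
  rw [Finset.sum_range_succ', Nat.cast_zero, zero_mul, mul_zero, add_zero, majorantSum]
  refine Finset.sum_congr rfl fun n _ => ?_
  have hn : ‖(n : ℂ) + 1‖ = n + 1 := by exact_mod_cast Complex.norm_natCast (n + 1)
  rw [taylorCoeff_deriv, norm_mul, hn, Nat.cast_succ, Nat.add_sub_cancel]
  ring

theorem majorantSum_succ_zero (f : ℂ → ℂ) (N : ℕ) : majorantSum f (N + 1) 0 = ‖f 0‖ := by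
  simp [majorantSum, Finset.sum_range_succ', taylorCoeff_zero]

theorem majorantSum_cexp_le {g : ℂ → ℂ} (hg : AnalyticAt ℂ g 0) {b B : ℝ → ℝ} {N : ℕ} {t : ℝ}
    (ht : 0 ≤ t) (hB : ∀ s ∈ Icc 0 t, HasDerivAt B (b s) s)
    (hb : ∀ s ∈ Ioo 0 t, majorantSum (deriv g) N s ≤ b s) :
    majorantSum (fun z => Complex.exp (g z)) N t ≤
      ‖Complex.exp (g 0)‖ * Real.exp (B t - B 0) := by
  set F : ℂ → ℂ := fun z => Complex.exp (g z) with hF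
  have hF' : deriv F =ᶠ[𝓝 0] fun z => deriv g z * F z := by
    filter_upwards [hg.eventually_analyticAt] with z hz
    rw [hF, deriv_cexp hz.differentiableAt, mul_comm]
  have hgrowth : ∀ s ∈ Ioo 0 t, majorantSum (deriv F) N s ≤ b s * majorantSum F (N + 1) s := by
    intro s hs
    calc majorantSum (deriv F) N s = majorantSum (fun z => deriv g z * F z) N s :=
          majorantSum_congr hF' N s
      _ ≤ majorantSum (deriv g) N s * majorantSum F N s :=
          majorantSum_mul_le hg.deriv hg.cexp' N hs.1.le
      _ ≤ b s * majorantSum F (N + 1) s := by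
          gcongr
          · exact majorantSum_nonneg F N hs.1.le
          · exact (majorantSum_nonneg _ N hs.1.le).trans (hb s hs)
          · exact hb s hs
          · exact majorantSum_le_succ F N hs.1.le
  calc majorantSum F N t ≤ majorantSum F (N + 1) t := majorantSum_le_succ F N ht
    _ ≤ majorantSum F (N + 1) 0 * Real.exp (B t - B 0) :=
        le_mul_exp_of_hasDerivAt_le_mul ht (fun s _ => hasDerivAt_majorantSum_succ F N s) hB hgrowth
    _ = ‖F 0‖ * Real.exp (B t - B 0) := by rw [majorantSum_succ_zero]

end MajorantOfExp

section InjectiveHolomorphicMaps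

theorem nhds_le_map_nhds_of_injOn {f : ℂ → ℂ} {U : Set ℂ} (hU : IsOpen U)
    (hf : DifferentiableOn ℂ f U) (hinj : InjOn f U) {b : ℂ} (hb : b ∈ U) :
    𝓝 (f b) ≤ map f (𝓝 b) := by
  refine ((hf.analyticAt (hU.mem_nhds hb)).eventually_constant_or_nhds_le_map_nhds).resolve_left ?_
  intro hconst
  have heq : ∀ᶠ z in 𝓝 b, z = b := by
    filter_upwards [hconst, hU.mem_nhds hb] with z hz hzU using hinj hzU hb hz
  obtain ⟨z, hzb, hzb'⟩ :=
    ((heq.filter_mono nhdsWithin_le_nhds).and (self_mem_nhdsWithin : {b}ᶜ ∈ 𝓝[≠] b)).exists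
  exact hzb' hzb

theorem isOpen_image_of_injOn {f : ℂ → ℂ} {U : Set ℂ} (hU : IsOpen U)
    (hf : DifferentiableOn ℂ f U) (hinj : InjOn f U) : IsOpen (f '' U) := by
  rw [isOpen_iff_mem_nhds]
  rintro _ ⟨b, hb, rfl⟩
  exact nhds_le_map_nhds_of_injOn hU hf hinj hb (image_mem_map (hU.mem_nhds hb))

theorem mem_frontier_image {f : ℂ → ℂ} {U : Set ℂ} (hU : IsOpen U)
    (hf : DifferentiableOn ℂ f U) (hinj : InjOn f U) {a : ℂ} (ha : a ∈ frontier U)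
    (hfa : ContinuousAt f a) : f a ∈ frontier (f '' U) := by
  rw [hU.frontier_eq] at ha
  rw [(isOpen_image_of_injOn hU hf hinj).frontier_eq]
  refine ⟨mem_closure_image hfa ha.1, ?_⟩
  rintro ⟨b, hb, hba⟩
  obtain ⟨V, W, hV, hW, haV, hbW, hVW⟩ := t2_separation (ne_of_mem_of_not_mem hb ha.2).symm
  have himage : f '' (W ∩ U) ∈ 𝓝 (f a) :=
    hba ▸ nhds_le_map_nhds_of_injOn hU hf hinj hb
      (image_mem_map ((hW.inter hU).mem_nhds ⟨hbW, hb⟩))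
  obtain ⟨z, ⟨hzV, w, ⟨hwW, hwU⟩, hwz⟩, hzU⟩ := mem_closure_iff_nhds.mp ha.1 _
    (inter_mem (hV.mem_nhds haV) (hfa himage))
  exact hVW.ne_of_mem hzV hwW (hinj hwU hzU hwz).symm

theorem hasDerivAt_invFunOn {f : ℂ → ℂ} {U : Set ℂ} (hU : IsOpen U)
    (hf : DifferentiableOn ℂ f U) (hinj : InjOn f U) {b : ℂ} (hb : b ∈ U) (hfb : deriv f b ≠ 0) :
    HasDerivAt (Function.invFunOn f U) (deriv f b)⁻¹ (f b) := by
  have hinv : ∀ z ∈ U, Function.invFunOn f U (f z) = z := fun z hz =>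
    hinj.leftInvOn_invFunOn hz
  have hcont : ContinuousAt (Function.invFunOn f U) (f b) := by
    have htendsto : Tendsto (Function.invFunOn f U) (map f (𝓝 b)) (𝓝 b) :=
      (tendsto_id.congr' (by
        filter_upwards [hU.mem_nhds hb] with z hz using (hinv z hz).symm) :
        Tendsto (Function.invFunOn f U ∘ f) (𝓝 b) (𝓝 b))
    rw [ContinuousAt, hinv b hb]
    exact htendsto.mono_left (nhds_le_map_nhds_of_injOn hU hf hinj hb)
  refine HasDerivAt.of_local_left_inverse (f := f) hcont ?_ hfb ?_
  · rw [hinv b hb]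
    exact (hf.differentiableAt (hU.mem_nhds hb)).hasDerivAt
  · filter_upwards [(isOpen_image_of_injOn hU hf hinj).mem_nhds (mem_image_of_mem f hb)] with w hw
      using Function.invFunOn_eq hw

theorem le_infEDist_frontier_image_ball {f : ℂ → ℂ} (hf : DifferentiableOn ℂ f (ball 0 1))
    (hinj : InjOn f (ball 0 1)) (hf0 : f 0 = 0) {c : ℝ} (hc : 0 < c)
    (hgrowth : ∀ z ∈ ball (0 : ℂ) 1, ‖z‖ * c ≤ ‖f z‖) :
    ENNReal.ofReal c ≤ infEDist (f 0) (frontier (f '' ball 0 1)) := by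
  rw [le_infEDist]
  intro y hy
  rw [(isOpen_image_of_injOn isOpen_ball hf hinj).frontier_eq] at hy
  rw [hf0, edist_comm, edist_dist, dist_zero_right]
  refine ENNReal.ofReal_le_ofReal (le_of_not_gt fun hlt => hy.2 ?_)
  obtain ⟨s, hys, hsc⟩ := exists_between hlt
  have hsub : closedBall (0 : ℂ) (s / c) ⊆ ball 0 1 :=
    closedBall_subset_ball ((div_lt_one hc).mpr hsc)
  have hclosed : IsClosed (f '' closedBall 0 (s / c)) :=
    ((isCompact_closedBall _ _).image_of_continuousOn (hf.continuousOn.mono hsub)).isClosed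
  have hnear : ball 0 s ∩ f '' ball 0 1 ⊆ f '' closedBall 0 (s / c) := by
    rintro _ ⟨hfx, x, hx, rfl⟩
    refine mem_image_of_mem f (mem_closedBall_zero_iff.mpr ?_)
    rw [le_div_iff₀ hc]
    exact (hgrowth x hx).trans (mem_ball_zero_iff.mp hfx).le
  have hmem : y ∈ closure (ball 0 s ∩ f '' ball 0 1) :=
    isOpen_ball.inter_closure ⟨mem_ball_zero_iff.mpr hys, hy.1⟩
  exact image_mono hsub (closure_minimal hnear hclosed hmem)

end InjectiveHolomorphicMaps

section JackLemma

open ComplexOrder in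
theorem conj_mul_deriv_nonneg_of_forall_norm_le {q : ℂ → ℂ} {z₀ : ℂ} (hq : DifferentiableAt ℂ q z₀)
    (hmax : ∀ z ∈ closedBall 0 ‖z₀‖, ‖q z‖ ≤ ‖q z₀‖) :
    0 ≤ (starRingEnd ℂ) (q z₀) * (z₀ * deriv q z₀) := by
  set C := (starRingEnd ℂ) (q z₀) * (z₀ * deriv q z₀) with hC
  have hlocal : IsLocalMaxOn (fun z => ‖q z‖ ^ 2) (closedBall 0 ‖z₀‖) z₀ :=
    (show IsMaxOn (fun z => ‖q z‖ ^ 2) (closedBall 0 ‖z₀‖) z₀ from fun z hz =>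
      pow_le_pow_left₀ (norm_nonneg _) (hmax z hz) 2).localize
  have hz₀ : z₀ ∈ closedBall 0 ‖z₀‖ := mem_closedBall_zero_iff.mpr le_rfl
  have hrotate : ∀ ζ : ℂ, ‖ζ‖ = 1 → (C * (ζ - 1)).re ≤ 0 := by
    intro ζ hζ
    have hζz : ζ * z₀ ∈ closedBall 0 ‖z₀‖ := by simp [hζ]
    have hcone := sub_mem_posTangentConeAt_of_segment_subset
      ((convex_closedBall (0 : ℂ) ‖z₀‖).segment_subset hz₀ hζz)
    have hle := hlocal.hasFDerivWithinAt_nonpos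
      hq.hasDerivAt.complexToReal_fderiv.norm_sq.hasFDerivWithinAt hcone
    have hinner : inner ℝ (q z₀) (deriv q z₀ * (ζ * z₀ - z₀)) = (C * (ζ - 1)).re := by
      rw [Complex.inner, hC]
      congr 1
      ring
    have htwice : 2 * (C * (ζ - 1)).re ≤ 0 := by
      simpa [hinner] using hle
    linarith
  obtain ⟨ζ, hζ, hζC⟩ := Complex.exists_norm_eq_mul_self C
  refine Complex.re_eq_norm.mp (le_antisymm (Complex.re_le_norm C) ?_)
  have h := hrotate ζ hζ
  rw [mul_sub, mul_one, mul_comm, ← hζC, Complex.sub_re, Complex.ofReal_re] at h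
  linarith

open ComplexOrder in
theorem exists_one_le_mul_deriv_eq {v : ℂ → ℂ} {z₀ : ℂ} {R : ℝ}
    (hv : DifferentiableOn ℂ v (ball 0 R)) (hz₀ : z₀ ∈ ball 0 R) (hv0 : v 0 = 0)
    (hvz₀ : v z₀ ≠ 0) (hmax : ∀ z ∈ closedBall 0 ‖z₀‖, ‖v z‖ ≤ ‖v z₀‖) :
    ∃ m : ℝ, 1 ≤ m ∧ z₀ * deriv v z₀ = m * v z₀ := by
  have hne : z₀ ≠ 0 := fun h => hvz₀ (h ▸ hv0)
  have hnorm : 0 < ‖z₀‖ := norm_pos_iff.mpr hne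
  set q := dslope v 0
  have hqv : ∀ z, v z = z * q z := fun z => by
    simpa using (sub_smul_dslope_of_zero hv0 z).symm
  have hqdiff : DifferentiableOn ℂ q (ball 0 R) :=
    (Complex.differentiableOn_dslope (ball_mem_nhds 0 (pos_of_mem_ball hz₀))).mpr hv
  have hqz₀ : DifferentiableAt ℂ q z₀ := hqdiff.differentiableAt (isOpen_ball.mem_nhds hz₀)
  have hsub : closedBall (0 : ℂ) ‖z₀‖ ⊆ ball 0 R :=
    closedBall_subset_ball (mem_ball_zero_iff.mp hz₀)
  have hqmax : ∀ z ∈ closedBall 0 ‖z₀‖, ‖q z‖ ≤ ‖q z₀‖ := by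
    intro z hz
    rw [← closure_ball (0 : ℂ) hnorm.ne'] at hz hsub
    refine Complex.norm_le_of_forall_mem_frontier_norm_le isBounded_ball
      (hqdiff.mono hsub).diffContOnCl (fun w hw => ?_) hz
    rw [frontier_ball _ hnorm.ne', mem_sphere_zero_iff_norm] at hw
    have h := hmax w (mem_closedBall_zero_iff.mpr hw.le)
    rw [hqv w, hqv z₀, norm_mul, norm_mul, hw] at h
    exact le_of_mul_le_mul_left h hnorm
  have hq0 : q z₀ ≠ 0 := right_ne_zero_of_mul (hqv z₀ ▸ hvz₀)
  obtain ⟨c, hc, hcq⟩ : ∃ c : ℝ, 0 ≤ c ∧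
      (c : ℂ) = (starRingEnd ℂ) (q z₀) * (z₀ * deriv q z₀) := RCLike.nonneg_iff_exists_ofReal.mp
    (conj_mul_deriv_nonneg_of_forall_norm_le hqz₀ hqmax)
  have hderiv : deriv v z₀ = q z₀ + z₀ * deriv q z₀ := by
    rw [funext hqv]
    simpa using ((hasDerivAt_id' z₀).fun_mul hqz₀.hasDerivAt).deriv
  refine ⟨1 + c / ‖q z₀‖ ^ 2, le_add_of_nonneg_right (by positivity), ?_⟩
  have hratio : z₀ * deriv q z₀ = c / ‖q z₀‖ ^ 2 * q z₀ := by
    rw [div_mul_eq_mul_div, eq_div_iff (by simpa using hq0), ← Complex.conj_mul', hcq]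
    ring
  rw [hderiv, hratio, hqv z₀]
  push_cast
  ring

theorem norm_le_norm_of_forall_mul_deriv_eq {v : ℂ → ℂ} {R : ℝ}
    (hv : DifferentiableOn ℂ v (ball 0 R)) (hv0 : v 0 = 0)
    (hcrit : ∀ z ∈ ball 0 R, ∀ m : ℝ, 1 ≤ m → z * deriv v z = m * v z → ‖v z‖ ≤ ‖z‖) :
    ∀ z ∈ ball 0 R, ‖v z‖ ≤ ‖z‖ := by
  intro z hz
  have hsub : closedBall (0 : ℂ) ‖z‖ ⊆ ball 0 R :=
    closedBall_subset_ball (mem_ball_zero_iff.mp hz)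
  have hzmem : z ∈ closedBall 0 ‖z‖ := mem_closedBall_zero_iff.mpr le_rfl
  obtain ⟨z₀, hz₀, hmax⟩ := (isCompact_closedBall (0 : ℂ) ‖z‖).exists_isMaxOn ⟨z, hzmem⟩
    (hv.continuousOn.mono hsub).norm
  have hz₀z : ‖z₀‖ ≤ ‖z‖ := mem_closedBall_zero_iff.mp hz₀
  by_contra! hlt
  have hlt₀ : ‖z₀‖ < ‖v z₀‖ := hz₀z.trans_lt (hlt.trans_le (hmax hzmem))
  obtain ⟨m, hm, hcritical⟩ := exists_one_le_mul_deriv_eq hv (hsub hz₀) hv0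
    (norm_pos_iff.mp ((norm_nonneg z₀).trans_lt hlt₀))
    fun w hw => hmax (closedBall_subset_closedBall hz₀z hw)
  exact hlt₀.not_ge (hcrit z₀ (hsub hz₀) m hm hcritical)

end JackLemma

section Subordination

theorem exists_first_exit_point {E F : Type*} [NormedAddCommGroup E] [ProperSpace E]
    [TopologicalSpace F] {g : E → F} {R : ℝ} {V : Set F} (hg : ContinuousOn g (ball 0 R))
    (hV : IsOpen V) (hexit : ¬ MapsTo g (ball 0 R) V) :
    ∃ z₀ ∈ ball 0 R, g z₀ ∉ V ∧ MapsTo g (ball 0 ‖z₀‖) V := by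
  obtain ⟨z₁, hz₁, hgz₁⟩ : ∃ z ∈ ball 0 R, g z ∉ V := by
    simpa only [MapsTo, not_forall, exists_prop] using hexit
  have hsub : closedBall (0 : E) ‖z₁‖ ⊆ ball 0 R :=
    closedBall_subset_ball (mem_ball_zero_iff.mp hz₁)
  have hcompact : IsCompact (closedBall (0 : E) ‖z₁‖ ∩ g ⁻¹' Vᶜ) :=
    (isCompact_closedBall _ _).of_isClosed_subset
      ((hg.mono hsub).preimage_isClosed_of_isClosed isClosed_closedBall hV.isClosed_compl)
      inter_subset_left
  obtain ⟨z₀, ⟨hz₀, hgz₀⟩, hmin⟩ := hcompact.exists_isMinOn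
    ⟨z₁, mem_closedBall_zero_iff.mpr le_rfl, hgz₁⟩ continuous_norm.continuousOn
  refine ⟨z₀, hsub hz₀, hgz₀, fun z hz => ?_⟩
  by_contra hgz
  rw [mem_ball_zero_iff] at hz
  exact hz.not_ge (hmin ⟨mem_closedBall_zero_iff.mpr
    (hz.le.trans (mem_closedBall_zero_iff.mp hz₀)), hgz⟩)

/-- A convex univalent function `K` on the unit disk. Convexity is encoded by Alexander's criterion
that `h(w) = w K'(w)` is starlike: `h` maps every disk `|w| < r ≤ 1` onto a domain starlike about
`0`, so that `|v| ≤ |w|` whenever `h(v)` lies on the segment from `0` to `h(w)`. -/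
structure IsConvexUnivalent (K : ℂ → ℂ) : Prop where
  differentiableOn : DifferentiableOn ℂ K (ball 0 1)
  injOn : InjOn K (ball 0 1)
  deriv_ne_zero : ∀ w ∈ ball 0 1, deriv K w ≠ 0
  norm_le_norm : ∀ v ∈ ball 0 1, ∀ w ∈ ball 0 1, ∀ m : ℝ, 1 ≤ m →
    w * deriv K w = m * (v * deriv K v) → ‖v‖ ≤ ‖w‖

namespace IsConvexUnivalent

variable {K g : ℂ → ℂ}

theorem exists_norm_le_eq_of_mapsTo (hK : IsConvexUnivalent K) {R : ℝ} (hR : R ≤ 1)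
    (hg : DifferentiableOn ℂ g (ball 0 R)) (hg0 : g 0 = K 0)
    (hsub : ∀ z ∈ ball 0 R, ∃ w, ‖w‖ ≤ ‖z‖ ∧ z * deriv g z = w * deriv K w)
    (hmaps : MapsTo g (ball 0 R) (K '' ball 0 1)) :
    ∀ z ∈ ball 0 R, ∃ u, ‖u‖ ≤ ‖z‖ ∧ g z = K u := by
  set v : ℂ → ℂ := fun z => Function.invFunOn K (ball 0 1) (g z)
  have hvmem : ∀ z ∈ ball 0 R, v z ∈ ball 0 1 := fun z hz => Function.invFunOn_mem (hmaps hz)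
  have hKv : ∀ z ∈ ball 0 R, K (v z) = g z := fun z hz => Function.invFunOn_eq (hmaps hz)
  have hderiv : ∀ z ∈ ball 0 R, HasDerivAt v ((deriv K (v z))⁻¹ * deriv g z) z := by
    intro z hz
    have hinv := hasDerivAt_invFunOn isOpen_ball hK.differentiableOn hK.injOn (hvmem z hz)
      (hK.deriv_ne_zero _ (hvmem z hz))
    rw [hKv z hz] at hinv
    exact hinv.comp z (hg.differentiableAt (isOpen_ball.mem_nhds hz)).hasDerivAt
  have hv0 : v 0 = 0 := by
    change Function.invFunOn K (ball 0 1) (g 0) = 0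
    rw [hg0]
    exact hK.injOn.leftInvOn_invFunOn (mem_ball_self one_pos)
  have hbound : ∀ z ∈ ball 0 R, ‖v z‖ ≤ ‖z‖ := by
    refine norm_le_norm_of_forall_mul_deriv_eq
      (fun z hz => (hderiv z hz).differentiableAt.differentiableWithinAt) hv0 ?_
    intro z hz m hm hcritical
    obtain ⟨w, hwz, hw⟩ := hsub z hz
    have hwmem : w ∈ ball 0 1 :=
      mem_ball_zero_iff.mpr (hwz.trans_lt ((mem_ball_zero_iff.mp hz).trans_le hR))
    refine (hK.norm_le_norm _ (hvmem z hz) w hwmem m hm ?_).trans hwz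
    have hK' := hK.deriv_ne_zero _ (hvmem z hz)
    rw [(hderiv z hz).deriv] at hcritical
    field_simp at hcritical
    rw [← hw, hcritical]
    ring
  exact fun z hz => ⟨v z, hbound z hz, (hKv z hz).symm⟩

theorem mapsTo_image_ball (hK : IsConvexUnivalent K) (hg : DifferentiableOn ℂ g (ball 0 1))
    (hg0 : g 0 = K 0)
    (hsub : ∀ z ∈ ball 0 1, ∃ w, ‖w‖ ≤ ‖z‖ ∧ z * deriv g z = w * deriv K w) :
    MapsTo g (ball 0 1) (K '' ball 0 1) := by
  by_contra hbad
  obtain ⟨z₀, hz₀, hgz₀, hmaps⟩ := exists_first_exit_point hg.continuousOn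
    (isOpen_image_of_injOn isOpen_ball hK.differentiableOn hK.injOn) hbad
  have hz₀lt : ‖z₀‖ < 1 := mem_ball_zero_iff.mp hz₀
  have hball₀ : ball (0 : ℂ) ‖z₀‖ ⊆ ball 0 1 := ball_subset_ball hz₀lt.le
  have hne : ‖z₀‖ ≠ 0 := fun h => hgz₀ <| by
    rw [norm_eq_zero.mp h, hg0]
    exact mem_image_of_mem K (mem_ball_self one_pos)
  have hclosedBall₀ : closedBall (0 : ℂ) ‖z₀‖ ⊆ ball 0 1 :=
    closedBall_subset_ball hz₀lt
  have himage : g '' ball 0 ‖z₀‖ ⊆ K '' closedBall 0 ‖z₀‖ := by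
    rintro _ ⟨z, hz, rfl⟩
    obtain ⟨u, hu, hgu⟩ := hK.exists_norm_le_eq_of_mapsTo hz₀lt.le (hg.mono hball₀) hg0
      (fun z hz => hsub z (hball₀ hz)) hmaps z hz
    exact ⟨u, mem_closedBall_zero_iff.mpr (hu.trans (mem_ball_zero_iff.mp hz).le), hgu.symm⟩
  have hclosed : IsClosed (K '' closedBall 0 ‖z₀‖) :=
    ((isCompact_closedBall _ _).image_of_continuousOn
      (hK.differentiableOn.continuousOn.mono hclosedBall₀)).isClosed
  have hclosure : z₀ ∈ closure (ball 0 ‖z₀‖) := by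
    rw [closure_ball _ hne]
    exact mem_closedBall_zero_iff.mpr le_rfl
  have hcont : ContinuousAt g z₀ := hg.continuousOn.continuousAt (isOpen_ball.mem_nhds hz₀)
  exact hgz₀ (image_mono hclosedBall₀
    (closure_minimal himage hclosed (mem_closure_image hcont hclosure)))

theorem exists_norm_le_eq (hK : IsConvexUnivalent K) (hg : DifferentiableOn ℂ g (ball 0 1))
    (hg0 : g 0 = K 0)
    (hsub : ∀ z ∈ ball 0 1, ∃ w, ‖w‖ ≤ ‖z‖ ∧ z * deriv g z = w * deriv K w) :
    ∀ z ∈ ball 0 1, ∃ u, ‖u‖ ≤ ‖z‖ ∧ g z = K u :=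
  hK.exists_norm_le_eq_of_mapsTo le_rfl hg hg0 hsub (hK.mapsTo_image_ball hg hg0 hsub)

end IsConvexUnivalent

end Subordination

section MaMindaRepresentation

theorem eqOn_of_mul_eq_mul {a b : ℂ → ℂ} {U : Set ℂ} (hU : IsOpen U) (ha : ContinuousOn a U)
    (hb : ContinuousOn b U) (hab : ∀ z ∈ U, z * a z = z * b z) : EqOn a b U :=
  EqOn.of_subset_closure (s := U ∩ {0}ᶜ) (fun z hz => mul_left_cancel₀ hz.2 (hab z hz.1)) ha hb
    inter_subset_left ((dense_compl_singleton (0 : ℂ)).open_subset_closure_inter hU)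

theorem eq_mul_cexp_of_deriv_eq_mul {F g : ℂ → ℂ} {U : Set ℂ} (hU : IsOpen U)
    (hU' : IsPreconnected U) (hF : DifferentiableOn ℂ F U) (hg : DifferentiableOn ℂ g U)
    (hderiv : ∀ z ∈ U, deriv F z = deriv g z * F z) {c z : ℂ} (hc : c ∈ U) (hz : z ∈ U) :
    F z = F c * Complex.exp (g z - g c) := by
  have hzero : ∀ w ∈ U, HasDerivAt (fun w => F w * Complex.exp (-g w)) 0 w := by
    intro w hw
    have hFw := (hF.differentiableAt (hU.mem_nhds hw)).hasDerivAt
    have hgw := (hg.differentiableAt (hU.mem_nhds hw)).hasDerivAt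
    refine (hFw.mul hgw.fun_neg.cexp).congr_deriv ?_
    rw [hderiv w hw]
    ring
  have hconst : F z * Complex.exp (-g z) = F c * Complex.exp (-g c) :=
    hU.is_const_of_deriv_eq_zero hU'
      (fun w hw => (hzero w hw).differentiableAt.differentiableWithinAt)
      (fun w hw => (hzero w hw).deriv) hz hc
  calc F z = F z * Complex.exp (-g z) * Complex.exp (g z) := by
        rw [mul_assoc, ← Complex.exp_add, neg_add_cancel, Complex.exp_zero, mul_one]
    _ = F c * Complex.exp (g z - g c) := by
        rw [hconst, mul_assoc, ← Complex.exp_add, neg_add_eq_sub]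

theorem exists_eq_deriv_mul_cexp {f p : ℂ → ℂ} (hf : DifferentiableOn ℂ f (ball 0 1))
    (hp : DifferentiableOn ℂ p (ball 0 1)) (hp0 : p 0 = 0)
    (hode : ∀ z ∈ ball 0 1, z * deriv f z = (1 + p z) * f z) :
    ∃ g : ℂ → ℂ, DifferentiableOn ℂ g (ball 0 1) ∧ g 0 = 0 ∧
      (∀ z ∈ ball 0 1, z * deriv g z = p z) ∧
      ∀ z ∈ ball 0 1, f z = deriv f 0 * z * Complex.exp (g z) := by
  have hnhds : ball (0 : ℂ) 1 ∈ 𝓝 0 := ball_mem_nhds 0 one_pos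
  have hzero : (0 : ℂ) ∈ ball 0 1 := mem_ball_self one_pos
  have hf0 : f 0 = 0 := by simpa [hp0] using (hode 0 hzero).symm
  set F := dslope f 0 with hFdef
  set q := dslope p 0
  have hF : DifferentiableOn ℂ F (ball 0 1) := (Complex.differentiableOn_dslope hnhds).mpr hf
  have hq : DifferentiableOn ℂ q (ball 0 1) := (Complex.differentiableOn_dslope hnhds).mpr hp
  have hfF : ∀ z, f z = z * F z := fun z => by
    simpa using (sub_smul_dslope_of_zero hf0 z).symm
  have hpq : ∀ z, p z = z * q z := fun z => by
    simpa using (sub_smul_dslope_of_zero hp0 z).symm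
  obtain ⟨g, hg0, hg⟩ := hq.isExactOn_ball.with_val_at 0 0
  have hgdiff : DifferentiableOn ℂ g (ball 0 1) := fun z hz =>
    (hg z hz).differentiableAt.differentiableWithinAt
  have hF' : EqOn (deriv F) (fun z => q z * F z) (ball 0 1) := by
    have hqF : ContinuousOn (fun z => q z * F z) (ball 0 1) := (hq.mul hF).continuousOn
    have hmul : ∀ z ∈ ball (0 : ℂ) 1, z * (z * deriv F z) = z * (z * (q z * F z)) := by
      intro z hz
      have hderiv : deriv f z = F z + z * deriv F z := by
        rw [funext hfF]
        simpa using ((hasDerivAt_id' z).fun_mul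
          (hF.differentiableAt (isOpen_ball.mem_nhds hz)).hasDerivAt).deriv
      have h := hode z hz
      rw [hderiv, hpq, hfF] at h
      linear_combination h
    have hF'cont : ContinuousOn (deriv F) (ball 0 1) := (hF.deriv isOpen_ball).continuousOn
    exact eqOn_of_mul_eq_mul isOpen_ball hF'cont hqF
      (eqOn_of_mul_eq_mul isOpen_ball (continuousOn_id.mul hF'cont) (continuousOn_id.mul hqF) hmul)
  refine ⟨g, hgdiff, hg0, fun z hz => by rw [(hg z hz).deriv, hpq], fun z hz => ?_⟩
  have hFexp := eq_mul_cexp_of_deriv_eq_mul isOpen_ball (convex_ball (0 : ℂ) 1).isPreconnected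
    hF hgdiff (fun w hw => by rw [hF' hw, (hg w hw).deriv]) hzero hz
  rw [hfF, hFexp, hg0, sub_zero, hFdef, dslope_same, mul_left_comm, mul_assoc]

theorem exists_eq_mul_cexp_of_mem_starlikeClass {φ f : ℂ → ℂ}
    (hφ : DifferentiableOn ℂ φ (ball 0 1)) (hf : f ∈ starlikeClass φ) :
    ∃ ω g : ℂ → ℂ, DifferentiableOn ℂ ω (ball 0 1) ∧ MapsTo ω (ball 0 1) (ball 0 1) ∧ ω 0 = 0 ∧
      DifferentiableOn ℂ g (ball 0 1) ∧ g 0 = 0 ∧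
      (∀ z ∈ ball 0 1, z * deriv g z = φ (ω z) - 1) ∧
      ∀ z ∈ ball 0 1, f z = z * Complex.exp (g z) := by
  obtain ⟨⟨hfdiff, hf0, hf'0, hinj⟩, ω, hω, hmaps, hω0, hquot⟩ := hf
  have hzero : (0 : ℂ) ∈ ball 0 1 := mem_ball_self one_pos
  have hφ0 : φ (ω 0) - 1 = 0 := by
    rw [← hquot 0 hzero, starlikeQuotient, if_pos rfl, sub_self]
  have hode : ∀ z ∈ ball 0 1, z * deriv f z = (1 + (φ (ω z) - 1)) * f z := by
    intro z hz
    rw [add_sub_cancel, ← hquot z hz, starlikeQuotient]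
    split_ifs with hz0
    · rw [hz0, hf0, zero_mul, mul_zero]
    · exact (div_mul_cancel₀ _ fun hfz => hz0 (hinj hz hzero (hfz.trans hf0.symm))).symm
  obtain ⟨g, hg, hg0, hg', hfg⟩ :=
    exists_eq_deriv_mul_cexp hfdiff ((hφ.comp hω hmaps).sub_const 1) hφ0 hode
  exact ⟨ω, g, hω, hmaps, hω0, hg, hg0, hg', fun z hz => by rw [hfg z hz, hf'0, one_mul]⟩

end MaMindaRepresentation

section StarlikeGrowth

variable {K φ : ℂ → ℂ}

theorem exists_norm_le_eq_mul_cexp (hK : IsConvexUnivalent K) (hK0 : K 0 = 0)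
    (hKφ : ∀ w ∈ ball 0 1, w * deriv K w = φ w - 1) {f : ℂ → ℂ} (hf : f ∈ starlikeClass φ) :
    ∀ z ∈ ball 0 1, ∃ u, ‖u‖ ≤ ‖z‖ ∧ f z = z * Complex.exp (K u) := by
  have hφ : DifferentiableOn ℂ φ (ball 0 1) :=
    ((differentiableOn_id.mul (hK.differentiableOn.deriv isOpen_ball)).const_add 1).congr
      fun w hw => by simp [hKφ w hw]
  obtain ⟨ω, g, hω, hmaps, hω0, hg, hg0, hg', hfg⟩ :=
    exists_eq_mul_cexp_of_mem_starlikeClass hφ hf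
  have hschwarz : ∀ z ∈ ball (0 : ℂ) 1, ‖ω z‖ ≤ ‖z‖ := fun z hz =>
    Complex.norm_le_norm_of_mapsTo_ball hω (hmaps.mono_right ball_subset_closedBall) hω0
      (mem_ball_zero_iff.mp hz)
  intro z hz
  obtain ⟨u, hu, hgu⟩ := hK.exists_norm_le_eq hg (hg0.trans hK0.symm)
    (fun z hz => ⟨ω z, hschwarz z hz, by rw [hg' z hz, hKφ _ (hmaps hz)]⟩) z hz
  exact ⟨u, hu, by rw [hfg z hz, hgu]⟩

end StarlikeGrowth

section SchwarzFunctions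

variable {ω : ℂ → ℂ} {t : ℝ}

theorem norm_dslope_le_one_of_mapsTo (hω : DifferentiableOn ℂ ω (ball 0 1))
    (hmaps : MapsTo ω (ball 0 1) (ball 0 1)) (hω0 : ω 0 = 0) :
    ∀ z ∈ ball 0 1, ‖dslope ω 0 z‖ ≤ 1 := fun z hz => by
  simpa using Complex.norm_dslope_le_div_of_mapsTo_ball hω
    (by rw [hω0]; exact hmaps.mono_right ball_subset_closedBall) hz

theorem majorantSum_dslope_le_one (hω : DifferentiableOn ℂ ω (ball 0 1))
    (hmaps : MapsTo ω (ball 0 1) (ball 0 1)) (hω0 : ω 0 = 0) (ht0 : 0 ≤ t) (ht : t ≤ 1 / 3)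
    (N : ℕ) : majorantSum (dslope ω 0) N t ≤ 1 :=
  majorantSum_le_one ((Complex.differentiableOn_dslope (ball_mem_nhds 0 one_pos)).mpr hω)
    (norm_dslope_le_one_of_mapsTo hω hmaps hω0) ht0 ht N

theorem majorantSum_le_self_of_mapsTo (hω : DifferentiableOn ℂ ω (ball 0 1))
    (hmaps : MapsTo ω (ball 0 1) (ball 0 1)) (hω0 : ω 0 = 0) (ht0 : 0 ≤ t) (ht : t ≤ 1 / 3)
    (N : ℕ) : majorantSum ω N t ≤ t := by
  have hnhds : ball (0 : ℂ) 1 ∈ 𝓝 0 := ball_mem_nhds 0 one_pos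
  have hψ : AnalyticAt ℂ (dslope ω 0) 0 :=
    ((Complex.differentiableOn_dslope hnhds).mpr hω).analyticAt hnhds
  have hωψ : ω = fun z => z * dslope ω 0 z := funext fun z => by
    simpa using (sub_smul_dslope_of_zero hω0 z).symm
  calc majorantSum ω N t
      = majorantSum (fun z => z * dslope ω 0 z) N t := by rw [← hωψ]
    _ ≤ majorantSum (fun z => z) N t * majorantSum (dslope ω 0) N t :=
        majorantSum_mul_le analyticAt_id hψ N ht0
    _ ≤ t * 1 := mul_le_mul (majorantSum_id_le N ht0)
        (majorantSum_dslope_le_one hω hmaps hω0 ht0 ht N) (majorantSum_nonneg _ N ht0) ht0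
    _ = t := mul_one t

end SchwarzFunctions

section Cardioid

/-- The primitive `∫₀ʷ (φ(s) - 1) / s ds = 4w/3 + w²/3` attached to the cardioid function
`φ(w) = 1 + 4w/3 + 2w²/3`. The extremal function of the cardioid class is `z` times its
exponential. -/
noncomputable def cardioidPrimitive (w : ℂ) : ℂ := 4 * w / 3 + w ^ 2 / 3

theorem hasDerivAt_cardioidPrimitive (w : ℂ) :
    HasDerivAt cardioidPrimitive (4 / 3 + 2 * w / 3) w := by
  refine ((((hasDerivAt_id w).const_mul 4).div_const 3).add
    ((hasDerivAt_pow 2 w).div_const 3)).congr_deriv ?_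
  norm_num

theorem differentiable_cardioidPrimitive : Differentiable ℂ cardioidPrimitive := fun w =>
  (hasDerivAt_cardioidPrimitive w).differentiableAt

theorem cardioidPrimitive_zero : cardioidPrimitive 0 = 0 := by
  simp [cardioidPrimitive]

theorem mul_deriv_cardioidPrimitive (w : ℂ) :
    w * deriv cardioidPrimitive w = 1 + 4 * w / 3 + 2 * w ^ 2 / 3 - 1 := by
  rw [(hasDerivAt_cardioidPrimitive w).deriv]
  ring

theorem norm_le_norm_of_mul_add_two_eq {v w : ℂ} {m : ℝ} (hv : ‖v‖ < 1) (hm : 1 ≤ m)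
    (h : w * (w + 2) = m * (v * (v + 2))) : ‖v‖ ≤ ‖w‖ := by
  by_contra! hlt
  have hv0 : v ≠ 0 := norm_pos_iff.mp ((norm_nonneg w).trans_lt hlt)
  obtain ⟨q, rfl⟩ : ∃ q, w = q * v := ⟨w / v, (div_mul_cancel₀ w hv0).symm⟩
  have hq : ‖q‖ < 1 := by
    rw [norm_mul] at hlt
    exact lt_of_mul_lt_mul_right (by rwa [one_mul]) (norm_nonneg v)
  have hre : q.re < 1 := (Complex.re_le_norm q).trans_lt hq
  have hfactor : v * (q ^ 2 - m) = 2 * (m - q) := by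
    apply mul_left_cancel₀ hv0
    linear_combination h
  have hdist : ‖1 - q‖ ≤ ‖(m : ℂ) - q‖ := by
    rw [← sq_le_sq₀ (norm_nonneg _) (norm_nonneg _), Complex.sq_norm, Complex.sq_norm,
      Complex.normSq_apply, Complex.normSq_apply]
    simp only [Complex.sub_re, Complex.sub_im, Complex.one_re, Complex.one_im, Complex.ofReal_re,
      Complex.ofReal_im]
    nlinarith
  have hpos : 0 < ‖(m : ℂ) - q‖ := hdist.trans_lt' <| norm_pos_iff.mpr <| sub_ne_zero.mpr <| by
    rintro rfl
    simp at hre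
  -- `‖q² - m‖ ≤ ‖m - q‖ + ‖q‖‖1 - q‖ < 2‖m - q‖`, whereas `‖v‖ < 1`
  have hnorm : ‖v‖ * ‖q ^ 2 - m‖ = 2 * ‖(m : ℂ) - q‖ := by
    rw [← norm_mul, hfactor, norm_mul, Complex.norm_ofNat]
  have htriangle : ‖q ^ 2 - m‖ ≤ ‖(m : ℂ) - q‖ + ‖q‖ * ‖1 - q‖ := by
    rw [← norm_mul, ← norm_neg (q ^ 2 - m), show -(q ^ 2 - m) = m - q + q * (1 - q) by ring]
    exact norm_add_le _ _
  have hsecond : ‖q‖ * ‖1 - q‖ < ‖(m : ℂ) - q‖ :=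
    (mul_le_mul_of_nonneg_left hdist (norm_nonneg q)).trans_lt (mul_lt_of_lt_one_left hpos hq)
  have hcontract : ‖v‖ * ‖q ^ 2 - m‖ ≤ ‖q ^ 2 - m‖ :=
    mul_le_of_le_one_left (norm_nonneg _) hv.le
  linarith

theorem isConvexUnivalent_cardioidPrimitive : IsConvexUnivalent cardioidPrimitive where
  differentiableOn := differentiable_cardioidPrimitive.differentiableOn
  injOn := by
    intro w hw u hu h
    have hsum : w + u + 4 ≠ 0 := by
      intro h4
      have hle := norm_add_le w u
      rw [eq_neg_of_add_eq_zero_left h4, norm_neg, Complex.norm_ofNat] at hle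
      linarith [mem_ball_zero_iff.mp hw, mem_ball_zero_iff.mp hu]
    have hmul : (w - u) * (w + u + 4) = 0 := by
      simp only [cardioidPrimitive] at h
      linear_combination 3 * h
    exact sub_eq_zero.mp ((mul_eq_zero.mp hmul).resolve_right hsum)
  deriv_ne_zero := by
    intro w hw h
    rw [(hasDerivAt_cardioidPrimitive w).deriv] at h
    have hw2 : w = -2 := by linear_combination 3 / 2 * h
    rw [mem_ball_zero_iff, hw2, norm_neg, Complex.norm_ofNat] at hw
    linarith
  norm_le_norm := by
    intro v hv w _ m hm h
    simp only [mul_deriv_cardioidPrimitive] at h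
    exact norm_le_norm_of_mul_add_two_eq (mem_ball_zero_iff.mp hv) hm
      (by linear_combination 3 / 2 * h)

theorem neg_one_le_re_cardioidPrimitive {u : ℂ} (hu : ‖u‖ ≤ 1) :
    -1 ≤ (cardioidPrimitive u).re := by
  have hsq : ‖u‖ ^ 2 ≤ 1 := pow_le_one₀ (norm_nonneg u) hu
  have hre : (cardioidPrimitive u).re = 4 * u.re / 3 + (u.re ^ 2 - u.im ^ 2) / 3 := by
    simp [cardioidPrimitive, pow_two]
  rw [Complex.sq_norm, Complex.normSq_apply] at hsq
  rw [hre]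
  linarith [sq_nonneg (u.re + 1)]

theorem norm_mul_exp_neg_one_le {f : ℂ → ℂ} (hf : f ∈ cardioidClass) :
    ∀ z ∈ ball 0 1, ‖z‖ * Real.exp (-1) ≤ ‖f z‖ := by
  intro z hz
  obtain ⟨u, hu, hfu⟩ := exists_norm_le_eq_mul_cexp isConvexUnivalent_cardioidPrimitive
    cardioidPrimitive_zero (fun w _ => mul_deriv_cardioidPrimitive w) hf z hz
  rw [hfu, norm_mul, Complex.norm_exp]
  gcongr
  exact neg_one_le_re_cardioidPrimitive (hu.trans (mem_ball_zero_iff.mp hz).le)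

theorem majorantSum_deriv_le {g ω : ℂ → ℂ} {t : ℝ} (hg : DifferentiableOn ℂ g (ball 0 1))
    (hω : DifferentiableOn ℂ ω (ball 0 1)) (hmaps : MapsTo ω (ball 0 1) (ball 0 1))
    (hω0 : ω 0 = 0) (hgω : ∀ z ∈ ball 0 1, z * deriv g z = 4 / 3 * ω z + 2 / 3 * ω z ^ 2)
    (ht0 : 0 ≤ t) (ht : t ≤ 1 / 3) (N : ℕ) :
    majorantSum (deriv g) N t ≤ 4 / 3 + 2 * t / 3 := by
  have hnhds : ball (0 : ℂ) 1 ∈ 𝓝 0 := ball_mem_nhds 0 one_pos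
  set ψ := dslope ω 0
  have hψ : DifferentiableOn ℂ ψ (ball 0 1) := (Complex.differentiableOn_dslope hnhds).mpr hω
  have hωψ : ∀ z, ω z = z * ψ z := fun z => by
    simpa using (sub_smul_dslope_of_zero hω0 z).symm
  have hderiv : EqOn (deriv g) (fun z => 4 / 3 * ψ z + 2 / 3 * (ψ z * ω z)) (ball 0 1) := by
    refine eqOn_of_mul_eq_mul isOpen_ball (hg.deriv isOpen_ball).continuousOn
      ((hψ.const_mul _).add ((hψ.mul hω).const_mul _)).continuousOn fun z hz => ?_
    rw [hgω z hz, hωψ]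
    ring
  have hψ0 : AnalyticAt ℂ ψ 0 := hψ.analyticAt hnhds
  have hωan : AnalyticAt ℂ ω 0 := hω.analyticAt hnhds
  have hψle : majorantSum ψ N t ≤ 1 := majorantSum_dslope_le_one hω hmaps hω0 ht0 ht N
  have hωle : majorantSum ω N t ≤ t := majorantSum_le_self_of_mapsTo hω hmaps hω0 ht0 ht N
  calc majorantSum (deriv g) N t
      = majorantSum (fun z => 4 / 3 * ψ z + 2 / 3 * (ψ z * ω z)) N t :=
        majorantSum_congr (hderiv.eventuallyEq_of_mem hnhds) N t
    _ ≤ 4 / 3 * majorantSum ψ N t + 2 / 3 * majorantSum (fun z => ψ z * ω z) N t := by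
        refine (majorantSum_add_le (f := fun z => 4 / 3 * ψ z) (g := fun z => 2 / 3 * (ψ z * ω z))
          (analyticAt_const.mul hψ0) (analyticAt_const.mul (hψ0.mul hωan)) N ht0).trans_eq ?_
        rw [majorantSum_const_mul, majorantSum_const_mul]
        norm_num
    _ ≤ 4 / 3 * 1 + 2 / 3 * (1 * t) := by
        gcongr
        exact (majorantSum_mul_le hψ0 hωan N ht0).trans
          (mul_le_mul hψle hωle (majorantSum_nonneg ω N ht0) zero_le_one)
    _ = 4 / 3 + 2 * t / 3 := by ring

theorem sum_norm_taylorCoeff_succ_le {f : ℂ → ℂ} (hf : f ∈ cardioidClass) {t : ℝ} (ht0 : 0 ≤ t)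
    (ht : t ≤ 1 / 3) (N : ℕ) :
    ∑ n ∈ Finset.range N, ‖taylorCoeff f (n + 1)‖ * t ^ n ≤ Real.exp (4 * t / 3 + t ^ 2 / 3) := by
  have hnhds : ball (0 : ℂ) 1 ∈ 𝓝 0 := ball_mem_nhds 0 one_pos
  obtain ⟨ω, g, hω, hmaps, hω0, hg, hg0, hgω, hfg⟩ :=
    exists_eq_mul_cexp_of_mem_starlikeClass (by fun_prop) hf
  have hg0an : AnalyticAt ℂ g 0 := hg.analyticAt hnhds
  have hcoeff : ∀ n, taylorCoeff f (n + 1) = taylorCoeff (fun z => Complex.exp (g z)) n :=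
    fun n => (taylorCoeff_congr (EqOn.eventuallyEq_of_mem hfg hnhds) (n + 1)).trans
      (taylorCoeff_id_mul_succ hg0an.cexp' n)
  have hB : ∀ s : ℝ, HasDerivAt (fun s : ℝ => 4 * s / 3 + s ^ 2 / 3) (4 / 3 + 2 * s / 3) s :=
    fun s => ((((hasDerivAt_id s).const_mul 4).div_const 3).add
      ((hasDerivAt_pow 2 s).div_const 3)).congr_deriv (by norm_num)
  have hexp := majorantSum_cexp_le hg0an (N := N) ht0 (fun s _ => hB s) fun s hs =>
    majorantSum_deriv_le hg hω hmaps hω0 (fun z hz => by rw [hgω z hz]; ring) hs.1.le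
      (hs.2.le.trans ht) N
  simpa [hcoeff, majorantSum, hg0] using hexp

end Cardioid

section StarlikeExtremal

theorem injOn_of_re_deriv_pos {F F' : ℂ → ℂ} {s : Set ℂ} (hs : Convex ℝ s)
    (hF : ∀ z ∈ s, HasDerivAt F (F' z) z) (hpos : ∀ z ∈ s, 0 < (F' z).re) : InjOn F s := by
  intro a ha b hb hab
  by_contra hne
  have hmem : ∀ t ∈ Icc (0 : ℝ) 1, a + t * (b - a) ∈ s := fun t ht => by
    simpa using hs.add_smul_sub_mem ha hb ht
  -- the real part of `F` along the segment, after turning the direction of the segment to `1`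
  set ℓ : ℝ → ℝ := fun t => (starRingEnd ℂ (b - a) * F (a + t * (b - a))).re with hℓ
  have hderiv : ∀ t ∈ Icc (0 : ℝ) 1,
      HasDerivAt ℓ (Complex.normSq (b - a) * (F' (a + t * (b - a))).re) t := by
    intro t ht
    have hline : HasDerivAt (fun t : ℂ => a + t * (b - a)) (b - a) (t : ℂ) := by
      simpa using ((hasDerivAt_id (t : ℂ)).mul_const (b - a)).const_add a
    refine (((hF _ (hmem t ht)).comp (t : ℂ) hline).const_mul
      (starRingEnd ℂ (b - a))).real_of_complex.congr_deriv ?_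
    rw [← Complex.re_ofReal_mul, ← Complex.mul_conj]
    ring_nf
  have hmono : StrictMonoOn ℓ (Icc 0 1) := by
    refine strictMonoOn_of_deriv_pos (convex_Icc _ _)
      (fun t ht => (hderiv t ht).continuousAt.continuousWithinAt) fun t ht => ?_
    have ht' : t ∈ Icc 0 1 := interior_subset ht
    rw [(hderiv t ht').deriv]
    exact mul_pos (Complex.normSq_pos.mpr (sub_ne_zero.mpr (Ne.symm hne))) (hpos _ (hmem t ht'))
  have hlt : ℓ 0 < ℓ 1 :=
    hmono (left_mem_Icc.mpr zero_le_one) (right_mem_Icc.mpr zero_le_one) one_pos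
  simp [hℓ, hab] at hlt

variable {K φ : ℂ → ℂ}

-- In the coordinate `s = log z`, with `re s < 0`, the logarithm of `z exp(K(z))` is `s + K(exp s)`,
-- whose derivative is `1 + z K'(z)`.
theorem injOn_mul_cexp (hK : DifferentiableOn ℂ K (ball 0 1))
    (hpos : ∀ z ∈ ball 0 1, 0 < (1 + z * deriv K z).re) :
    InjOn (fun z => z * Complex.exp (K z)) (ball 0 1) := by
  have hexp : ∀ {s : ℂ}, s.re < 0 → Complex.exp s ∈ ball 0 1 := fun hs => by
    rwa [mem_ball_zero_iff, Complex.norm_exp, Real.exp_lt_one_iff]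
  have hlog : InjOn (fun s => s + K (Complex.exp s)) {s | s.re < 0} := by
    refine injOn_of_re_deriv_pos (convex_halfSpace_re_lt 0)
      (F' := fun s => 1 + Complex.exp s * deriv K (Complex.exp s)) (fun s hs => ?_)
      fun s hs => hpos _ (hexp hs)
    have hKexp := (hK.differentiableAt (isOpen_ball.mem_nhds (hexp hs))).hasDerivAt.comp s
      (Complex.hasDerivAt_exp s)
    exact ((hasDerivAt_id s).add hKexp).congr_deriv (by ring)
  have hre : ∀ {z : ℂ}, z ∈ ball 0 1 → z ≠ 0 → (Complex.log z).re < 0 := fun {z} hz hz0 => by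
    rw [Complex.log_re]
    exact Real.log_neg (norm_pos_iff.mpr hz0) (mem_ball_zero_iff.mp hz)
  intro z hz w hw hzw
  by_cases hz0 : z = 0
  · simpa [hz0, eq_comm] using hzw
  have hw0 : w ≠ 0 := by
    rintro rfl
    simp [hz0] at hzw
  have hsum : Complex.exp (Complex.log z + K z) = Complex.exp (Complex.log w + K w) := by
    simpa only [Complex.exp_add, Complex.exp_log hz0, Complex.exp_log hw0] using hzw
  obtain ⟨n, hn⟩ := Complex.exp_eq_exp_iff_exists_int.mp hsum
  have hexpw : Complex.exp (Complex.log w + n * (2 * Real.pi * Complex.I)) = w := by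
    rw [Complex.exp_periodic.int_mul n (Complex.log w), Complex.exp_log hw0]
  have hlogzw : Complex.log z = Complex.log w + n * (2 * Real.pi * Complex.I) := by
    refine hlog (hre hz hz0) (by simpa using hre hw hw0) ?_
    simp only [hexpw, Complex.exp_log hz0]
    rw [hn]
    ring
  rw [← Complex.exp_log hz0, hlogzw, hexpw]

theorem mul_cexp_mem_starlikeClass (hK : DifferentiableOn ℂ K (ball 0 1)) (hK0 : K 0 = 0)
    (hKφ : ∀ w ∈ ball 0 1, w * deriv K w = φ w - 1) (hφ : ∀ w ∈ ball 0 1, 0 < (φ w).re) :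
    (fun z => z * Complex.exp (K z)) ∈ starlikeClass φ := by
  have hzero : (0 : ℂ) ∈ ball 0 1 := mem_ball_self one_pos
  have hφ' : ∀ z ∈ ball 0 1, 1 + z * deriv K z = φ z := fun z hz => by
    rw [hKφ z hz, add_sub_cancel]
  have hderiv : ∀ z ∈ ball (0 : ℂ) 1,
      HasDerivAt (fun z => z * Complex.exp (K z)) (φ z * Complex.exp (K z)) z := by
    intro z hz
    refine ((hasDerivAt_id' z).fun_mul
      (hK.differentiableAt (isOpen_ball.mem_nhds hz)).hasDerivAt.cexp).congr_deriv ?_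
    rw [← hφ' z hz]
    ring
  refine ⟨⟨fun z hz => (hderiv z hz).differentiableAt.differentiableWithinAt, zero_mul _, ?_,
    injOn_mul_cexp hK fun z hz => by rw [hφ' z hz]; exact hφ z hz⟩,
    fun z => z, differentiableOn_id, mapsTo_id _, rfl, fun z hz => ?_⟩
  · rw [(hderiv 0 hzero).deriv, ← hφ' 0 hzero, hK0]
    simp
  · rw [starlikeQuotient]
    split_ifs with hz0
    · rw [hz0, ← hφ' 0 hzero, zero_mul, add_zero]
    · rw [(hderiv z hz).deriv]
      field_simp [Complex.exp_ne_zero]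

end StarlikeExtremal

section CardioidExtremal

/-- The function `z exp(4z/3 + z²/3)`, which is extremal in the cardioid class. -/
noncomputable def cardioidExtremal (z : ℂ) : ℂ := z * Complex.exp (cardioidPrimitive z)

theorem re_cardioid_pos {z : ℂ} (hz : z ∈ ball 0 1) :
    0 < (1 + 4 * z / 3 + 2 * z ^ 2 / 3).re := by
  have hsq : ‖z‖ ^ 2 < 1 := pow_lt_one₀ (norm_nonneg z) (mem_ball_zero_iff.mp hz) two_ne_zero
  have hre : (1 + 4 * z / 3 + 2 * z ^ 2 / 3).re =
      1 + 4 * z.re / 3 + 2 * (z.re ^ 2 - z.im ^ 2) / 3 := by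
    simp [pow_two]
  rw [Complex.sq_norm, Complex.normSq_apply] at hsq
  rw [hre]
  nlinarith [sq_nonneg (2 * z.re + 1)]

theorem cardioidExtremal_mem : cardioidExtremal ∈ cardioidClass :=
  mul_cexp_mem_starlikeClass differentiable_cardioidPrimitive.differentiableOn
    cardioidPrimitive_zero (fun w _ => mul_deriv_cardioidPrimitive w) fun _ => re_cardioid_pos

theorem cardioidExtremal_ofReal (x : ℝ) :
    cardioidExtremal x = ((x * Real.exp (4 * x / 3 + x ^ 2 / 3) : ℝ) : ℂ) := by
  simp [cardioidExtremal, cardioidPrimitive]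

theorem neg_exp_neg_one_mem_frontier :
    ((-Real.exp (-1) : ℝ) : ℂ) ∈ frontier (cardioidExtremal '' ball 0 1) := by
  have hvalue : cardioidExtremal ((-1 : ℝ) : ℂ) = ((-Real.exp (-1) : ℝ) : ℂ) := by
    rw [cardioidExtremal_ofReal]
    norm_num
  have hdiff : Differentiable ℂ cardioidExtremal :=
    differentiable_id.mul differentiable_cardioidPrimitive.cexp
  rw [← hvalue]
  refine mem_frontier_image isOpen_ball hdiff.differentiableOn cardioidExtremal_mem.1.2.2.2 ?_
    hdiff.continuous.continuousAt
  simp [frontier_ball]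

end CardioidExtremal

section BohrRadius

variable {f : ℂ → ℂ}

theorem bohr_sum_eq (hf'0 : deriv f 0 = 1) (z : ℂ) :
    ‖z‖ₑ + ∑' n : ℕ, ‖taylorCoeff f (n + 2)‖ₑ * ‖z‖ₑ ^ (n + 2) =
      ∑' n : ℕ, ‖taylorCoeff f (n + 1) * z ^ (n + 1)‖ₑ := by
  rw [tsum_eq_zero_add' (f := fun n => ‖taylorCoeff f (n + 1) * z ^ (n + 1)‖ₑ) ENNReal.summable]
  simp [enorm_mul, enorm_pow, taylorCoeff_one, hf'0]

theorem hasSum_taylorCoeff_succ (hf : DifferentiableOn ℂ f (ball 0 1)) (hf0 : f 0 = 0) {z : ℂ}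
    (hz : z ∈ ball 0 1) : HasSum (fun n => taylorCoeff f (n + 1) * z ^ (n + 1)) (f z) := by
  have hsum : HasSum (fun n => taylorCoeff f n * z ^ n) (f z) := by
    refine (Complex.hasSum_taylorSeries_on_ball hf hz).congr_fun fun n => ?_
    rw [taylorCoeff, sub_zero, smul_eq_mul, smul_eq_mul]
    ring
  simpa [taylorCoeff_zero, hf0] using (hasSum_nat_add_iff' 1).mpr hsum

theorem enorm_le_infEDist_of_bohrInequality (hf : f ∈ classS) {z : ℂ} (hz : z ∈ ball 0 1)
    (hbohr : BohrInequality f z) :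
    ‖f z‖ₑ ≤ infEDist (f 0) (frontier (f '' ball 0 1)) := by
  obtain ⟨hfdiff, hf0, hf'0, -⟩ := hf
  rw [BohrInequality, bohr_sum_eq hf'0] at hbohr
  rw [← (hasSum_taylorCoeff_succ hfdiff hf0 hz).tsum_eq]
  exact enorm_tsum_le_tsum_enorm.trans hbohr

theorem bohrInequality_of_mem_cardioidClass (hf : f ∈ cardioidClass) {z : ℂ} (hz : ‖z‖ ≤ 1 / 3)
    (hle : ‖z‖ * Real.exp (4 * ‖z‖ / 3 + ‖z‖ ^ 2 / 3) ≤ Real.exp (-1)) :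
    BohrInequality f z := by
  obtain ⟨hfdiff, hf0, hf'0, hinj⟩ := hf.1
  have hterm : ∀ n, ‖taylorCoeff f (n + 1) * z ^ (n + 1)‖ₑ =
      ENNReal.ofReal (‖z‖ * (‖taylorCoeff f (n + 1)‖ * ‖z‖ ^ n)) := fun n => by
    rw [← ofReal_norm, norm_mul, norm_pow, pow_succ', mul_left_comm]
  have hpartial : ∀ N, ∑ n ∈ Finset.range N, ‖taylorCoeff f (n + 1) * z ^ (n + 1)‖ₑ ≤
      ENNReal.ofReal (Real.exp (-1)) := by
    intro N
    simp_rw [hterm]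
    rw [← ENNReal.ofReal_sum_of_nonneg fun _ _ => by positivity, ← Finset.mul_sum]
    refine ENNReal.ofReal_le_ofReal (le_trans ?_ hle)
    gcongr
    exact sum_norm_taylorCoeff_succ_le hf (norm_nonneg z) hz N
  rw [BohrInequality, bohr_sum_eq hf'0]
  exact (ENNReal.tsum_le_of_sum_range_le hpartial).trans <| le_infEDist_frontier_image_ball hfdiff
    hinj hf0 (Real.exp_pos (-1)) (norm_mul_exp_neg_one_le hf)

theorem not_bohrInequality_cardioidExtremal {ρ : ℝ} (hρ0 : 0 ≤ ρ) (hρ1 : ρ < 1)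
    (hlt : Real.exp (-1) < ρ * Real.exp (4 * ρ / 3 + ρ ^ 2 / 3)) :
    ¬ BohrInequality cardioidExtremal ρ := by
  intro hbohr
  have hρ : (ρ : ℂ) ∈ ball (0 : ℂ) 1 := by
    rwa [mem_ball_zero_iff, Complex.norm_real, Real.norm_of_nonneg hρ0]
  have hle := (enorm_le_infEDist_of_bohrInequality cardioidExtremal_mem.1 hρ hbohr).trans
    (infEDist_le_edist_of_mem neg_exp_neg_one_mem_frontier)
  rw [cardioidExtremal_mem.1.2.1, edist_comm, edist_zero_right, enorm_le_iff_norm_le,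
    cardioidExtremal_ofReal, Complex.norm_real, Complex.norm_real, norm_neg,
    Real.norm_of_nonneg (by positivity), Real.norm_of_nonneg (by positivity)] at hle
  exact hlt.not_ge hle

theorem strictMonoOn_mul_exp :
    StrictMonoOn (fun x : ℝ => x * Real.exp (4 * x / 3 + x ^ 2 / 3)) (Ici 0) := by
  intro x hx y hy hxy
  rw [mem_Ici] at hx hy
  beta_reduce
  gcongr

theorem exists_root_mul_exp :
    ∃ r ∈ Ioo (0 : ℝ) (1 / 3), r * Real.exp (4 * r / 3 + r ^ 2 / 3) = Real.exp (-1) := by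
  have hcont : ContinuousOn (fun x : ℝ => x * Real.exp (4 * x / 3 + x ^ 2 / 3))
      (Icc 0 (1 / 3)) := by fun_prop
  -- multiplied by `3e`, this is `3 < exp(1 + 4/9 + 1/27)`
  have hright : Real.exp (-1) < 1 / 3 * Real.exp (4 * (1 / 3) / 3 + (1 / 3) ^ 2 / 3) := by
    have hsplit : Real.exp (4 * (1 / 3) / 3 + (1 / 3) ^ 2 / 3) =
        Real.exp (40 / 27) * Real.exp (-1) := by
      rw [← Real.exp_add]
      norm_num
    have hthree : 3 < Real.exp (40 / 27) :=
      lt_of_lt_of_le (by norm_num) (Real.quadratic_le_exp_of_nonneg (x := 40 / 27) (by norm_num))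
    rw [hsplit]
    nlinarith [Real.exp_pos (-1)]
  exact intermediate_value_Ioo (by norm_num) hcont ⟨by simpa using Real.exp_pos (-1), hright⟩

end BohrRadius

theorem corollary2p5 :
    ∃ rf : ℝ,
      IsLeast {r : ℝ | r ∈ Set.Ioo (0 : ℝ) 1 ∧
        r * Real.exp (4 * r / 3 + r ^ 2 / 3) = Real.exp (-1)} rf ∧
      0 < rf ∧ rf < 1 / 3 ∧
      (∀ f ∈ cardioidClass, ∀ z : ℂ, ‖z‖ ≤ rf → BohrInequality f z) ∧
      (∀ ρ : ℝ, rf < ρ → ρ < 1 →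
        ∃ f ∈ cardioidClass, ∃ z : ℂ, ‖z‖ = ρ ∧ ¬ BohrInequality f z) := by
  obtain ⟨rf, ⟨hrf0, hrf3⟩, hrf⟩ := exists_root_mul_exp
  refine ⟨rf, ⟨⟨⟨hrf0, by linarith⟩, hrf⟩, ?_⟩, hrf0, hrf3, ?_, ?_⟩
  · rintro r ⟨⟨hr0, -⟩, hr⟩
    exact (strictMonoOn_mul_exp.injOn hrf0.le hr0.le (hrf.trans hr.symm)).le
  · intro f hf z hz
    refine bohrInequality_of_mem_cardioidClass hf (hz.trans hrf3.le) ?_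
    rw [← hrf]
    exact strictMonoOn_mul_exp.monotoneOn (norm_nonneg z) hrf0.le hz
  · intro ρ hρ hρ1
    have hρ0 : 0 ≤ ρ := hrf0.le.trans hρ.le
    refine ⟨cardioidExtremal, cardioidExtremal_mem, ρ, ?_,
      not_bohrInequality_cardioidExtremal hρ0 hρ1 ?_⟩
    · rw [Complex.norm_real, Real.norm_of_nonneg hρ0]
    · rw [← hrf]
      exact strictMonoOn_mul_exp hrf0.le hρ0 hρ
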